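/- Let $n\ge 0$ and let $Z\subset\mathbb{P}^n=\mathbb{P}^n_{\mathbb{C}}$ be a finite set of points. For $j\in\mathbb{Z}$, $j\ge 0$, let $h_Z(j)$ be the rank of the linear map that evaluates the forms of degree $j$ in $n+1$ variables over $\mathbb{C}$ at a set of vectors in $\mathbb{C}^{n+1}\setminus\{0\}$ representing the points of $Z$, one for each point (the rank does not depend on the choice of representatives); put $h_Z(j)=0$ for $j<0$, and $Dh_Z(j)=h_Z(j)-h_Z(j-1)$ for $j\in\mathbb{Z}$. For $i\in\mathbb{Z}$, the set $Z$ is said to satisfy the Cayley–Bacharach property $CB(i)$ if for every $P\in Z$, every form of degree $i$ vanishing at all points of $Z\setminus\{P\}$ also vanishes at $P$ (the only form of negative degree is $0$). **Theorem.** If $Z$ satisfies $CB(i)$, then for every integer $j$ with $0\le j\le i+1$, $$Dh_Z(0)+Dh_Z(1)+\cdots+Dh_Z(j)\ \le\ Dh_Z(i+1-j)+\cdots+Dh_Z(i+1).$$ -/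

import Mathlib

namespace PointSets

/-- Complex projective `n`-space, as the set of lines in `ℂ^(n+1)`. -/
abbrev ProjSpace (n : ℕ) : Type := Projectivization ℂ (Fin (n + 1) → ℂ)

/-- The space of forms of degree `i` in `n + 1` variables over `ℂ`, for an integer `i`;
the only form of negative degree is `0`. -/
noncomputable def forms (n : ℕ) (i : ℤ) : Submodule ℂ (MvPolynomial (Fin (n + 1)) ℂ) :=
  if 0 ≤ i then MvPolynomial.homogeneousSubmodule (Fin (n + 1)) ℂ i.toNat else ⊥

/-- The evaluation map of degree `i` on a family `Y` of vectors in `ℂ^(n+1)`. -/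
noncomputable def evalMap {n : ℕ} {ι : Type} (Y : ι → Fin (n + 1) → ℂ) (i : ℤ) :
    forms n i →ₗ[ℂ] (ι → ℂ) :=
  (LinearMap.pi fun a => (MvPolynomial.aeval (Y a)).toLinearMap) ∘ₗ (forms n i).subtype

/-- A polynomial vanishes at a projective point. For a form this does not depend on the
representative, see `vanishesAt_mk_iff`. -/
def VanishesAt {n : ℕ} (F : MvPolynomial (Fin (n + 1)) ℂ) (P : ProjSpace n) : Prop :=
  MvPolynomial.eval P.rep F = 0

/-- The Hilbert function `h_Z : ℤ → ℕ` of a finite set `Z` of projective points: the rank of the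
evaluation map on a set of representatives of `Z`. It does not depend on the representatives, see
`hilbertFunction_eq_finrank`. -/
noncomputable def hilbertFunction {n : ℕ} (Z : Finset (ProjSpace n)) (i : ℤ) : ℕ :=
  Module.finrank ℂ (LinearMap.range (evalMap (fun P : Z => P.1.rep) i))

/-- The first difference `Dh_Z(i) = h_Z(i) - h_Z(i - 1)` of the Hilbert function. -/
noncomputable def diffHilbert {n : ℕ} (Z : Finset (ProjSpace n)) (i : ℤ) : ℤ :=
  (hilbertFunction Z i : ℤ) - (hilbertFunction Z (i - 1) : ℤ)

/-- The Cayley-Bacharach property `CB(i)`: for every `P ∈ Z`, every form of degree `i` that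
vanishes at `Z \ {P}` also vanishes at `P`. -/
def CayleyBacharach {n : ℕ} (Z : Finset (ProjSpace n)) (i : ℤ) : Prop :=
  ∀ P ∈ Z, ∀ F ∈ forms n i, (∀ Q ∈ Z, Q ≠ P → VanishesAt F Q) → VanishesAt F P

theorem eval_smul_of_mem_forms {n : ℕ} {i : ℤ} {F : MvPolynomial (Fin (n + 1)) ℂ}
    (hF : F ∈ forms n i) (c : ℂ) (v : Fin (n + 1) → ℂ) :
    MvPolynomial.eval (c • v) F = c ^ i.toNat * MvPolynomial.eval v F := by
  unfold forms at hF
  split_ifs at hF with h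
  · have hF' : F.IsHomogeneous i.toNat := hF
    rw [MvPolynomial.eval_eq, MvPolynomial.eval_eq, Finset.mul_sum]
    refine Finset.sum_congr rfl fun d hd => ?_
    have hdeg : ∑ k ∈ d.support, d k = i.toNat := by
      have := hF' (MvPolynomial.mem_support_iff.mp hd)
      rwa [Finsupp.weight_apply, Finsupp.sum, Finset.sum_congr rfl
        (fun k _ => by simp : ∀ k ∈ d.support, d k • (1 : Fin (n + 1) → ℕ) k = d k)] at this
    simp only [Pi.smul_apply, smul_eq_mul, mul_pow, Finset.prod_mul_distrib,
      Finset.prod_pow_eq_pow_sum, hdeg]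
    ring
  · rw [Submodule.mem_bot] at hF
    simp [hF]

theorem vanishesAt_mk_iff {n : ℕ} {i : ℤ} {F : MvPolynomial (Fin (n + 1)) ℂ}
    (hF : F ∈ forms n i) (v : Fin (n + 1) → ℂ) (hv : v ≠ 0) :
    VanishesAt F (Projectivization.mk ℂ v hv) ↔ MvPolynomial.eval v F = 0 := by
  obtain ⟨a, ha⟩ := Projectivization.exists_smul_eq_mk_rep ℂ v hv
  unfold VanishesAt
  rw [← ha, Units.smul_def, eval_smul_of_mem_forms hF]
  simp

theorem hilbertFunction_eq_finrank {n : ℕ} (Z : Finset (ProjSpace n)) (i : ℤ)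
    (Y : Z → Fin (n + 1) → ℂ) (hY : ∀ P, Y P ≠ 0)
    (hYZ : ∀ P, Projectivization.mk ℂ (Y P) (hY P) = P.1) :
    hilbertFunction Z i = Module.finrank ℂ (LinearMap.range (evalMap Y i)) := by
  have hker : LinearMap.ker (evalMap (fun P : Z => P.1.rep) i) = LinearMap.ker (evalMap Y i) := by
    ext F
    simp only [LinearMap.mem_ker, funext_iff]
    refine forall_congr' fun P => ?_
    have h := vanishesAt_mk_iff F.2 (Y P) (hY P)
    rw [hYZ P] at h
    exact h
  unfold hilbertFunction
  refine LinearEquiv.finrank_eq ?_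
  exact (LinearMap.quotKerEquivRange _).symm.trans
    ((Submodule.quotEquivOfEq _ _ hker).trans (LinearMap.quotKerEquivRange _))

end PointSets

namespace PointSets

open MvPolynomial

/-! The sums telescope, so for `j ≤ i` the claim is h(j) + h(i-j) ≤ h(i+1). By `CB(i)` some
degree-`i` relation is nonzero at every point of `Z`. A maximal tight `Y ⊆ Z` then has the same
forms vanishing on it as `Z` in degrees up to `i+1` (`exists_isTight_of_relation`), and imposes
independent conditions in degree `i+1`, so h(i+1) = |Y|. A relation `w` with support `Y` gives the
nondegenerate form ∑ w a b on ℂ^Y, for which evaluations of degrees `j` and `i-j` are orthogonal;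
their ranks therefore add up to at most |Y|. -/

theorem mul_mem_forms {n : ℕ} {k l : ℤ} (hk : 0 ≤ k) (hl : 0 ≤ l)
    {F G : MvPolynomial (Fin (n + 1)) ℂ} (hF : F ∈ forms n k) (hG : G ∈ forms n l) :
    F * G ∈ forms n (k + l) := by
  unfold forms at *
  rw [if_pos hk] at hF
  rw [if_pos hl] at hG
  rw [if_pos (by omega), Int.toNat_add hk hl]
  exact IsHomogeneous.mul (φ := F) (ψ := G) hF hG

theorem X_pow_mem_forms {n : ℕ} (a : Fin (n + 1)) (m : ℕ) :
    (X a : MvPolynomial (Fin (n + 1)) ℂ) ^ m ∈ forms n m := by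
  unfold forms
  rw [if_pos (by omega), Int.toNat_natCast]
  exact isHomogeneous_X_pow a m

/-! ### Relations and linear algebra on ℂ^ι -/

variable {n : ℕ} {ι : Type} [Fintype ι]

/-- The linear relations between the evaluations of forms of degree `k` at a family of vectors. -/
def relations (v : ι → Fin (n + 1) → ℂ) (k : ℤ) : Submodule ℂ (ι → ℂ) where
  carrier := {w | ∀ F ∈ forms n k, ∑ p, w p * eval (v p) F = 0}
  zero_mem' := by simp
  add_mem' := by
    intro a b ha hb F hF
    simp [add_mul, Finset.sum_add_distrib, ha F hF, hb F hF]
  smul_mem' := by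
    intro c a ha F hF
    simp [mul_assoc, ← Finset.mul_sum, ha F hF]

theorem coord_mul_mem_relations {v : ι → Fin (n + 1) → ℂ} {k : ℤ} (hk : 0 ≤ k) {w : ι → ℂ}
    (hw : w ∈ relations v (k + 1)) (a : Fin (n + 1)) :
    (fun p => v p a * w p) ∈ relations v k := by
  intro F hF
  have hX : (X a : MvPolynomial (Fin (n + 1)) ℂ) ∈ forms n 1 := by
    simpa using X_pow_mem_forms a 1
  rw [← hw _ (mul_mem_forms hk zero_le_one hF hX)]
  refine Finset.sum_congr rfl fun p _ => ?_
  simp only [map_mul, eval_X]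
  ring

/-- Over `ℂ`, a sum of two vectors of a subspace can be scaled to have no cancellation. -/
theorem exists_mem_support_union (W : Submodule ℂ (ι → ℂ)) {u w : ι → ℂ} (hu : u ∈ W)
    (hw : w ∈ W) : ∃ x ∈ W, ∀ p, x p ≠ 0 ↔ u p ≠ 0 ∨ w p ≠ 0 := by
  classical
  obtain ⟨t, ht⟩ := Infinite.exists_notMem_finset
    (insert 0 (Finset.univ.image fun p => -(u p / w p)))
  simp only [Finset.mem_insert, Finset.mem_image, Finset.mem_univ, true_and, not_or,
    not_exists] at ht
  refine ⟨u + t • w, W.add_mem hu (W.smul_mem t hw), fun p => ?_⟩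
  simp only [Pi.add_apply, Pi.smul_apply, smul_eq_mul]
  by_cases h : w p = 0
  · simp [h]
  · simp only [h, ne_eq, not_false_eq_true, or_true, iff_true]
    intro h0
    refine ht.2 p ?_
    field_simp
    linear_combination -h0

theorem exists_mem_forall_ne_zero (W : Submodule ℂ (ι → ℂ)) (h : ∀ p, ∃ w ∈ W, w p ≠ 0) :
    ∃ w ∈ W, ∀ p, w p ≠ 0 := by
  classical
  suffices H : ∀ s : Finset ι, ∃ w ∈ W, ∀ p ∈ s, w p ≠ 0 by
    obtain ⟨w, hw, h⟩ := H Finset.univ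
    exact ⟨w, hw, fun p => h p (Finset.mem_univ p)⟩
  intro s
  induction s using Finset.induction_on with
  | empty => exact ⟨0, W.zero_mem, by simp⟩
  | insert q s _ ih =>
    obtain ⟨w, hw, hs⟩ := ih
    obtain ⟨u, hu, hq⟩ := h q
    obtain ⟨x, hx, hxs⟩ := exists_mem_support_union W hu hw
    refine ⟨x, hx, fun p hp => (hxs p).2 ?_⟩
    rcases Finset.mem_insert.1 hp with rfl | hp
    · exact Or.inl hq
    · exact Or.inr (hs p hp)

theorem exists_orthogonal_of_notMem (V : Submodule ℂ (ι → ℂ)) {f : ι → ℂ} (hf : f ∉ V) :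
    ∃ w : ι → ℂ, (∀ g ∈ V, ∑ p, w p * g p = 0) ∧ ∑ p, w p * f p ≠ 0 := by
  classical
  obtain ⟨φ, hφ, hV⟩ := Submodule.exists_le_ker_of_notMem hf
  have key : ∀ g, ∑ p, φ (Pi.single p 1) * g p = φ g := by
    intro g
    rw [LinearMap.pi_apply_eq_sum_univ φ g]
    refine Finset.sum_congr rfl fun p _ => ?_
    rw [smul_eq_mul, mul_comm]
    congr 2
    ext q
    simp [Pi.single_apply, eq_comm]
  refine ⟨fun p => φ (Pi.single p 1), fun g hg => ?_, ?_⟩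
  · rw [key]; exact hV hg
  · rw [key]; exact hφ

/-- Nonzero weights make the diagonal form nondegenerate, so `A` embeds in the annihilator of `B`.
-/
theorem finrank_add_finrank_le_card (A B : Submodule ℂ (ι → ℂ)) {w : ι → ℂ}
    (hw : ∀ p, w p ≠ 0) (hAB : ∀ a ∈ A, ∀ b ∈ B, ∑ p, w p * (a p * b p) = 0) :
    Module.finrank ℂ A + Module.finrank ℂ B ≤ Fintype.card ι := by
  classical
  let T : (ι → ℂ) →ₗ[ℂ] Module.Dual ℂ (ι → ℂ) :=
    LinearMap.mk₂ ℂ (fun a b => ∑ p, w p * (a p * b p))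
      (by intros; simp [add_mul, mul_add, Finset.sum_add_distrib])
      (by intros; simp only [Pi.smul_apply, smul_eq_mul, Finset.mul_sum]
          exact Finset.sum_congr rfl fun _ _ => by ring)
      (by intros; simp [mul_add, Finset.sum_add_distrib])
      (by intros; simp only [Pi.smul_apply, smul_eq_mul, Finset.mul_sum]
          exact Finset.sum_congr rfl fun _ _ => by ring)
  have hT : Function.Injective T := by
    rw [injective_iff_map_eq_zero]
    intro a ha
    ext p
    have := LinearMap.congr_fun ha (Pi.single p 1)
    simpa [T, Pi.single_apply, hw p] using this
  have hle : A.map T ≤ B.dualAnnihilator := by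
    rintro _ ⟨a, ha, rfl⟩
    rw [Submodule.mem_dualAnnihilator]
    exact fun b hb => hAB a ha b hb
  have h1 := Submodule.finrank_mono hle
  rw [← (Submodule.equivMapOfInjective T hT A).finrank_eq] at h1
  have h2 := Subspace.finrank_add_finrank_dualAnnihilator_eq B
  rw [Module.finrank_fintype_fun_eq_card] at h2
  omega

theorem eq_top_of_no_orthogonal (V : Submodule ℂ (ι → ℂ))
    (h : ∀ w : ι → ℂ, (∀ g ∈ V, ∑ p, w p * g p = 0) → w = 0) : V = ⊤ := by
  by_contra hV
  obtain ⟨f, hf⟩ : ∃ f, f ∉ V := by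
    by_contra! H
    exact hV (eq_top_iff.2 fun f _ => H f)
  obtain ⟨w, hw, hwf⟩ := exists_orthogonal_of_notMem V hf
  exact hwf (by simp [h w hw])

/-! ### Tight sets -/

/-- A set that supports a relation of degree `k` but no relation of degree `k + 1`. -/
def IsTight (v : ι → Fin (n + 1) → ℂ) (k : ℤ) (Y : Finset ι) : Prop :=
  (∃ w ∈ relations v k, ∀ p, w p ≠ 0 ↔ p ∈ Y) ∧
    ∀ m ∈ relations v (k + 1), (∀ p ∉ Y, m p = 0) → m = 0

theorem isTight_empty (v : ι → Fin (n + 1) → ℂ) (k : ℤ) : IsTight v k ∅ :=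
  ⟨⟨0, Submodule.zero_mem _, by simp⟩, fun _ _ h => funext fun p => h p (by simp)⟩

/-- `Y` is enlarged by the support of a relation nonzero at `p` whose support outside `Y` is as
small as possible. Minimality makes this relation unique up to scaling outside `Y`. -/
theorem IsTight.exists_ssuperset {v : ι → Fin (n + 1) → ℂ}
    (hv0 : ∀ p, v p ≠ 0)
    (hv : ∀ p q (a b : ℂ), a ≠ 0 → b ≠ 0 → a • v p = b • v q → p = q)
    {k : ℤ} (hk : 0 ≤ k) {Y : Finset ι} (hY : IsTight v k Y)
    {w₀ : ι → ℂ} (hw₀ : w₀ ∈ relations v k) {p : ι} (hp₀ : w₀ p ≠ 0)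
    {F : MvPolynomial (Fin (n + 1)) ℂ} (hF : F ∈ forms n (k + 1))
    (hFY : ∀ q ∈ Y, eval (v q) F = 0) (hFp : eval (v p) F ≠ 0) :
    ∃ Y', Y ⊂ Y' ∧ IsTight v k Y' := by
  classical
  let C : (ι → ℂ) → Finset ι := fun w => Finset.univ.filter fun q => w q ≠ 0 ∧ q ∉ Y
  have hpY : p ∉ Y := fun h => hFp (hFY p h)
  obtain ⟨w, ⟨hw, hwp⟩, hmin⟩ : ∃ w, (w ∈ relations v k ∧ w p ≠ 0) ∧
      ∀ u, (u ∈ relations v k ∧ u p ≠ 0) → (C w).card ≤ (C u).card := by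
    let S : Set (ι → ℂ) := {u | u ∈ relations v k ∧ u p ≠ 0}
    have hS : S.Nonempty := ⟨w₀, hw₀, hp₀⟩
    exact ⟨Function.argminOn (fun u => (C u).card) S hS,
      Function.argminOn_mem (fun u => (C u).card) S hS,
      fun u hu => Function.argminOn_le (fun u => (C u).card) S hu⟩
  have hunique : ∀ u ∈ relations v k, u p = 0 → (∀ q, q ∉ Y → w q = 0 → u q = 0) →
      ∀ q, q ∉ Y → u q = 0 := by
    intro u hu hup hsub q hqY
    by_contra huq
    -- This combination cancels `q`, keeps the value at `p`, and gains no support outside `Y`.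
    refine absurd (hmin (w - (w q / u q) • u)
      ⟨Submodule.sub_mem _ hw (Submodule.smul_mem _ _ hu), by simpa [hup] using hwp⟩) ?_
    rw [not_le]
    refine Finset.card_lt_card (Finset.ssubset_iff_of_subset ?_ |>.2 ⟨q, ?_, ?_⟩)
    · intro r hr
      simp only [C, Finset.mem_filter, Finset.mem_univ, true_and] at hr ⊢
      refine ⟨fun h => hr.1 ?_, hr.2⟩
      simp [h, hsub r hr.2 h]
    · simp only [C, Finset.mem_filter, Finset.mem_univ, true_and]
      exact ⟨fun h => huq (hsub q hqY h), hqY⟩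
    · simp [C, huq]
  obtain ⟨⟨y, hy, hyY⟩, hind⟩ := hY
  obtain ⟨x, hx, hxs⟩ := exists_mem_support_union _ hy hw
  refine ⟨Finset.univ.filter fun q => x q ≠ 0, ?_, ⟨x, hx, by simp⟩, ?_⟩
  · refine Finset.ssubset_iff_of_subset (fun q hq => ?_) |>.2 ⟨p, ?_, hpY⟩
    · simpa using (hxs q).2 (Or.inl ((hyY q).2 hq))
    · simpa using (hxs p).2 (Or.inr hwp)
  intro m hm hms
  have hms' : ∀ q, q ∉ Y → w q = 0 → m q = 0 := by
    intro q hqY hwq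
    refine hms q ?_
    simp only [Finset.mem_filter, Finset.mem_univ, true_and]
    rw [hxs q, hyY q]
    simp [hqY, hwq]
  -- Each coordinate times `m` has degree `k`, so outside `Y` it is a multiple of `w`.
  have hprop : ∀ q, q ∉ Y → (m q * w p) • v q = (m p * w q) • v p := by
    intro q hqY
    ext a
    have := hunique ((fun r => v r a * m r) - (v p a * m p / w p) • w)
      (Submodule.sub_mem _ (coord_mul_mem_relations hk hm a) (Submodule.smul_mem _ _ hw))
      (by simp [hwp]) (fun r hrY hr => by simp [hr, hms' r hrY hr]) q hqY
    simp only [Pi.sub_apply, Pi.smul_apply, smul_eq_mul] at this ⊢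
    field_simp at this
    linear_combination this
  have hmp : m p = 0 := by
    by_contra hmp
    have honly : ∀ q, q ∉ Y → q ≠ p → m q = 0 := by
      intro q hqY hqp
      by_contra hmq
      have hwq : w q ≠ 0 := fun h => hmq (hms' q hqY h)
      exact hqp (hv q p _ _ (mul_ne_zero hmq hwp) (mul_ne_zero hmp hwq) (hprop q hqY))
    have hsum := hm F hF
    -- `F` kills the terms in `Y`, and `m` the other terms off `p`.
    rw [Finset.sum_eq_single p] at hsum
    · exact (mul_ne_zero hmp hFp) hsum
    · intro q _ hqp
      by_cases hqY : q ∈ Y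
      · simp [hFY q hqY]
      · simp [honly q hqY hqp]
    · simp
  refine hind m hm fun q hqY => ?_
  have := hprop q hqY
  rw [hmp, zero_mul, zero_smul, smul_eq_zero] at this
  rcases this with h | h
  · exact (mul_eq_zero.1 h).resolve_right hwp
  · exact absurd h (hv0 q)

theorem exists_isTight_of_relation {v : ι → Fin (n + 1) → ℂ}
    (hv0 : ∀ p, v p ≠ 0)
    (hv : ∀ p q (a b : ℂ), a ≠ 0 → b ≠ 0 → a • v p = b • v q → p = q)
    {k : ℤ} (hk : 0 ≤ k) {w₀ : ι → ℂ} (hw₀ : w₀ ∈ relations v k) (hne : ∀ p, w₀ p ≠ 0) :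
    ∃ Y, IsTight v k Y ∧ ∀ F ∈ forms n (k + 1), (∀ q ∈ Y, eval (v q) F = 0) →
      ∀ p, eval (v p) F = 0 := by
  obtain ⟨Y, hY⟩ := Set.Finite.exists_maximal (Set.toFinite {Y : Finset ι | IsTight v k Y})
    ⟨∅, isTight_empty v k⟩
  refine ⟨Y, hY.prop, fun F hF hFY p => ?_⟩
  by_contra hFp
  obtain ⟨Y', hYY', hY'⟩ := hY.prop.exists_ssuperset hv0 hv hk hw₀ (hne p) hF hFY hFp
  exact hYY'.2 (hY.le_of_ge hY' hYY'.1)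

theorem finrank_range_evalMap_add_le {v : ι → Fin (n + 1) → ℂ}
    (hv0 : ∀ p, v p ≠ 0)
    (hv : ∀ p q (a b : ℂ), a ≠ 0 → b ≠ 0 → a • v p = b • v q → p = q)
    {k l : ℤ} (hk : 0 ≤ k) (hl : 0 ≤ l) {w₀ : ι → ℂ} (hw₀ : w₀ ∈ relations v (k + l))
    (hne : ∀ p, w₀ p ≠ 0) :
    Module.finrank ℂ (LinearMap.range (evalMap v k)) +
      Module.finrank ℂ (LinearMap.range (evalMap v l)) ≤
      Module.finrank ℂ (LinearMap.range (evalMap v (k + l + 1))) := by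
  classical
  obtain ⟨Y, ⟨⟨w, hw, hwY⟩, hind⟩, hY⟩ :=
    exists_isTight_of_relation hv0 hv (add_nonneg hk hl) hw₀ hne
  have hres : ∀ d : ℤ, 0 ≤ d → d ≤ k + l + 1 →
      Module.finrank ℂ (LinearMap.range (evalMap v d)) =
        Module.finrank ℂ (LinearMap.range (evalMap (fun q : Y => v q) d)) := by
    intro d hd hdk
    have hker : LinearMap.ker (evalMap v d) = LinearMap.ker (evalMap (fun q : Y => v q) d) := by
      ext F
      simp only [LinearMap.mem_ker, funext_iff]
      refine ⟨fun h q => h q, fun h p => ?_⟩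
      -- Multiplying by a power of a coordinate nonzero at `p` lifts the degree to `k + l + 1`.
      obtain ⟨a, ha⟩ := Function.ne_iff.1 (hv0 p)
      obtain ⟨m, hm⟩ := Int.eq_ofNat_of_zero_le (sub_nonneg.2 hdk)
      have hmem : F.1 * X a ^ m ∈ forms n (k + l + 1) := by
        have := mul_mem_forms hd (Int.natCast_nonneg m) F.2 (X_pow_mem_forms a m)
        rwa [← hm, add_sub_cancel] at this
      have hz := hY _ hmem (fun q hq => by
        have hq' : eval (v q) F.1 = 0 := h ⟨q, hq⟩
        simp [hq']) p
      rw [map_mul, map_pow, eval_X] at hz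
      exact (mul_eq_zero.1 hz).resolve_right (pow_ne_zero _ ha)
    exact LinearEquiv.finrank_eq ((LinearMap.quotKerEquivRange _).symm.trans
      ((Submodule.quotEquivOfEq _ _ hker).trans (LinearMap.quotKerEquivRange _)))
  have htop : LinearMap.range (evalMap (fun q : Y => v q) (k + l + 1)) = ⊤ := by
    refine eq_top_of_no_orthogonal _ fun u hu => ?_
    let m : ι → ℂ := fun p => if h : p ∈ Y then u ⟨p, h⟩ else 0
    have hm : m = 0 := by
      refine hind m (fun F hF => ?_) fun p hp => by simp [m, hp]
      have h1 := hu _ ⟨⟨F, hF⟩, rfl⟩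
      have h2 : ∑ p ∈ Y, m p * eval (v p) F = ∑ p, m p * eval (v p) F :=
        Finset.sum_subset (Finset.subset_univ _) fun p _ hp => by simp [m, hp]
      rw [← h2, ← Finset.sum_coe_sort, ← h1]
      exact Finset.sum_congr rfl fun q _ => by simp [m, evalMap, aeval_eq_eval]
    ext q
    simpa [m] using congrFun hm q.1
  rw [hres k hk (by omega), hres l hl (by omega), hres (k + l + 1) (by omega) le_rfl, htop,
    finrank_top, Module.finrank_fintype_fun_eq_card]
  refine finrank_add_finrank_le_card _ _ (w := fun q : Y => w q) (fun q => (hwY q).2 q.2) ?_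
  rintro _ ⟨F, rfl⟩ _ ⟨G, rfl⟩
  rw [← hw _ (mul_mem_forms hk hl F.2 G.2),
    ← Finset.sum_subset (Finset.subset_univ Y) fun p _ hp => by
      rw [not_not.1 (mt (hwY p).1 hp), zero_mul], ← Finset.sum_coe_sort Y]
  exact Finset.sum_congr rfl fun q _ => by simp [evalMap, aeval_eq_eval]

/-! ### Cayley–Bacharach sets and Hilbert functions -/

/-- The indicator of `P` is not an evaluation vector, so some relation is nonzero at `P`; a generic
combination serves all points. -/
theorem CayleyBacharach.exists_relation {Z : Finset (ProjSpace n)} {i : ℤ}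
    (h : CayleyBacharach Z i) :
    ∃ w ∈ relations (fun P : Z => P.1.rep) i, ∀ P, w P ≠ 0 := by
  classical
  refine exists_mem_forall_ne_zero _ fun P => ?_
  have hP : Pi.single P (1 : ℂ) ∉ LinearMap.range (evalMap (fun P : Z => P.1.rep) i) := by
    rintro ⟨F, hF⟩
    have hval : ∀ Q : Z, eval Q.1.rep F.1 = (Pi.single P (1 : ℂ) : Z → ℂ) Q :=
      fun Q => congrFun hF Q
    have h0 : eval P.1.rep F.1 = 0 := h P.1 P.2 F.1 F.2 fun Q hQ hQP =>
      (hval ⟨Q, hQ⟩).trans (Pi.single_eq_of_ne (fun e => hQP (congrArg Subtype.val e)) _)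
    rw [hval P, Pi.single_eq_same] at h0
    exact one_ne_zero h0
  obtain ⟨w, hw, hwP⟩ := exists_orthogonal_of_notMem _ hP
  exact ⟨w, fun F hF => hw _ ⟨⟨F, hF⟩, rfl⟩, by simpa [Pi.single_apply] using hwP⟩

theorem CayleyBacharach.hilbertFunction_add_le {Z : Finset (ProjSpace n)} {i : ℤ}
    (h : CayleyBacharach Z i) {j : ℤ} (hj₀ : 0 ≤ j) (hj : j ≤ i) :
    hilbertFunction Z j + hilbertFunction Z (i - j) ≤ hilbertFunction Z (i + 1) := by
  obtain ⟨w, hw, hne⟩ := h.exists_relation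
  have hi : j + (i - j) = i := by omega
  have := finrank_range_evalMap_add_le (v := fun P : Z => P.1.rep) (fun P => P.1.rep_nonzero)
    (fun P Q a b ha hb hab => Subtype.ext ?_) hj₀ (sub_nonneg.2 hj) (by rwa [hi]) hne
  · rwa [hi] at this
  · rw [← P.1.mk_rep, ← Q.1.mk_rep, Projectivization.mk_eq_mk_iff']
    refine ⟨a⁻¹ * b, ?_⟩
    rw [mul_smul, ← hab, smul_smul, inv_mul_cancel₀ ha, one_smul]

theorem hilbertFunction_of_neg (Z : Finset (ProjSpace n)) {i : ℤ} (hi : i < 0) :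
    hilbertFunction Z i = 0 := by
  have h : evalMap (fun P : Z => P.1.rep) i = 0 := by
    ext F P
    have hbot : forms n i = ⊥ := if_neg (by omega)
    have hF : F.1 = 0 := (Submodule.mem_bot ℂ).1 (hbot.le F.2)
    simp [evalMap, hF]
  unfold hilbertFunction
  rw [h, LinearMap.range_zero, finrank_bot]

theorem sum_Icc_diffHilbert (Z : Finset (ProjSpace n)) {a b : ℤ} (hab : a ≤ b + 1) :
    ∑ k ∈ Finset.Icc a b, diffHilbert Z k = hilbertFunction Z b - hilbertFunction Z (a - 1) := by
  obtain ⟨b, rfl⟩ : ∃ c, b = c - 1 := ⟨b + 1, by ring⟩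
  rw [sub_add_cancel] at hab
  induction b, hab using Int.leInduction with
  | base => simp
  | succ m hm ih =>
    have : Finset.Icc a (m + 1 - 1) = insert m (Finset.Icc a (m - 1)) := by
      ext x
      simp only [Finset.mem_Icc, Finset.mem_insert]
      omega
    rw [this, Finset.sum_insert (by simp), ih, diffHilbert, add_sub_cancel_right]
    ring

end PointSets

theorem mainTheorem3 (n : ℕ) (Z : Finset (PointSets.ProjSpace n)) (i : ℤ)
    (hCB : PointSets.CayleyBacharach Z i) (j : ℤ) (hj₀ : 0 ≤ j) (hj : j ≤ i + 1) :
    ∑ k ∈ Finset.Icc 0 j, PointSets.diffHilbert Z k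
      ≤ ∑ k ∈ Finset.Icc (i + 1 - j) (i + 1), PointSets.diffHilbert Z k := by
  rw [PointSets.sum_Icc_diffHilbert Z (by omega), PointSets.sum_Icc_diffHilbert Z (by omega),
    PointSets.hilbertFunction_of_neg Z (by omega : (0 : ℤ) - 1 < 0),
    show i + 1 - j - 1 = i - j by ring]
  rcases hj.eq_or_lt with rfl | hlt
  -- For `j = i + 1` both sides equal h(i+1), since h(-1) = 0.
  · rw [PointSets.hilbertFunction_of_neg Z (by omega : i - (i + 1) < 0)]
  · have := hCB.hilbertFunction_add_le hj₀ (by omega : j ≤ i)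
    omega
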